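/- All logarithms are to base 2. Let $\mathcal{X},\mathcal{Y}$ be finite sets, $P_{XY}$ a probability distribution on $\mathcal{X}\times\mathcal{Y}$, $n\ge 1$, and let $(X^n,Y^n)$ have the i.i.d. distribution $P_{XY}^n$. A Wyner-Ahlswede-Körner (WAK) code of blocklength $n$ is a triple $\tilde\Phi_n=(\tilde\varphi_0,\tilde\varphi_2,\tilde\psi)$ of maps $\tilde\varphi_0:\mathcal{X}^n\to\tilde{\mathcal{M}}_0$, $\tilde\varphi_2:\mathcal{Y}^n\to\tilde{\mathcal{M}}_2$, $\tilde\psi:\tilde{\mathcal{M}}_0\times\tilde{\mathcal{M}}_2\to\mathcal{Y}^n$ with finite message sets, and its error probability is $\mathrm{P}_{\mathtt{WAK}}(\tilde\Phi_n|P_{XY}^n)=\Pr\big(\tilde\psi(\tilde\varphi_0(X^n),\tilde\varphi_2(Y^n))\ne Y^n\big)$. For $\delta\in\mathbb{R}$ and a distribution $P$ of a pair $(X,Y)$ on $\mathcal{X}\times\mathcal{Y}$, let $\mathcal{R}^*_{\mathtt{WAK}}(\delta|P)$ be the set of pairs $(r_0,r_2)\in\mathbb{R}^2$ for which there is a test channel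 $P_{W|XY}$ with $|\mathcal{W}|\le|\mathcal{X}||\mathcal{Y}|+2$ satisfying $$r_0\ge I(W\wedge X,Y),\qquad r_2\ge H(Y|W),\qquad \delta\ge I(W\wedge Y|X).$$ Then for every WAK code $\tilde\Phi_n$, $$\mathrm{P}_{\mathtt{WAK}}(\tilde\Phi_n|P_{XY}^n)\ \ge\ \Pr\Big((\tilde r_{0,n},\tilde r_{2,n})\notin\mathcal{R}^*_{\mathtt{WAK}}(\delta_n|\mathsf{t}_{X^nY^n}),\ \mathsf{t}_{X^n}\in\mathcal{E}_n\Big)\Big(1-\frac1n\Big),$$ where $\mathsf{t}_{X^nY^n}$ and $\mathsf{t}_{X^n}$ are the types (empirical distributions) of $(X^n,Y^n)$ and of $X^n$, $$\tilde r_{0,n}=\frac1n\log|\tilde{\mathcal{M}}_0|+\Delta_n+\frac{\log\log|\mathcal{X}|+2}{n},\qquad \tilde r_{2,n}=\frac1n\log|\tilde{\mathcal{M}}_2|+\frac{1+\log|\mathcal{Y}|}{n},$$ $$\delta_n=\Delta_n+\frac{\log\log|\mathcal{X}|+3+\log|\mathcal{X}|}{n},\qquad \Delta_n=\frac{(|\mathcal{X}|(|\mathcal{Y}|+1)+3)\log(n+1)}{n},$$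 and $\mathcal{E}_n$ is the set of types $P_{\bar X}$ of sequences in $\mathcal{X}^n$ with $H(\bar X)\ge\frac1n\log|\tilde{\mathcal{M}}_0|+\frac{|\mathcal{X}|\log(n+1)}{n}$. (If $|\mathcal{X}|=1$, then $\mathcal{E}_n$ is empty, so the value given to $\log\log|\mathcal{X}|$ is immaterial.) -/

import Mathlib

noncomputable section

namespace WAK

/-! ### Finite probability: mass functions, laws, Shannon information measures (base 2) -/

/-- Probability of the event `A` under the mass function `p` on a finite set. -/
def prob {Ω : Type*} [Fintype Ω] (p : Ω → ℝ) (A : Set Ω) : ℝ :=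
  ∑ ω, A.indicator p ω

/-- The law (mass function) of the random variable `f` under `p`. -/
def law {Ω α : Type*} [Fintype Ω] (p : Ω → ℝ) (f : Ω → α) : α → ℝ :=
  fun a => prob p {ω | f ω = a}

/-- Shannon entropy in bits of a mass function. -/
def entropy {α : Type*} [Fintype α] (q : α → ℝ) : ℝ :=
  -∑ a, q a * Real.logb 2 (q a)

/-- Conditional entropy `H(f | g)` in bits of two random variables on `(Ω, p)`. -/
def condEntropy {Ω α β : Type*} [Fintype Ω] [Fintype α] [Fintype β]
    (p : Ω → ℝ) (f : Ω → α) (g : Ω → β) : ℝ :=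
  -∑ a, ∑ b, law p (fun ω => (f ω, g ω)) (a, b) *
    Real.logb 2 (law p (fun ω => (f ω, g ω)) (a, b) / law p g b)

/-- Mutual information `I(f ∧ g)` in bits of two random variables on `(Ω, p)`. -/
def mutualInfo {Ω α β : Type*} [Fintype Ω] [Fintype α] [Fintype β]
    (p : Ω → ℝ) (f : Ω → α) (g : Ω → β) : ℝ :=
  ∑ a, ∑ b, law p (fun ω => (f ω, g ω)) (a, b) *
    Real.logb 2 (law p (fun ω => (f ω, g ω)) (a, b) / (law p f a * law p g b))

/-- Conditional mutual information `I(f ∧ g | h)` in bits of random variables on `(Ω, p)`. -/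
def condMutualInfo {Ω α β γ : Type*} [Fintype Ω] [Fintype α] [Fintype β] [Fintype γ]
    (p : Ω → ℝ) (f : Ω → α) (g : Ω → β) (h : Ω → γ) : ℝ :=
  ∑ a, ∑ b, ∑ c, law p (fun ω => (f ω, g ω, h ω)) (a, b, c) *
    Real.logb 2 (law p (fun ω => (f ω, g ω, h ω)) (a, b, c) * law p h c /
      (law p (fun ω => (f ω, h ω)) (a, c) * law p (fun ω => (g ω, h ω)) (b, c)))

/-- The type (empirical distribution) of a sequence of length `n`. -/
def type {α : Type*} {n : ℕ} (s : Fin n → α) : α → ℝ :=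
  fun a => ({i : Fin n | s i = a}.ncard : ℝ) / n

/-- The product law `P_{XY}^n` on pairs of sequences. -/
def iidLaw {X Y : Type*} (P : X × Y → ℝ) (n : ℕ) :
    (Fin n → X) × (Fin n → Y) → ℝ :=
  fun s => ∏ i, P (s.1 i, s.2 i)

/-! ### Codes -/

/-- A code of blocklength `n` for the Wyner-Ahlswede-Körner network:
`enc0` is the helper's encoder (observing `X^n`), `enc2` is the main encoder (observing `Y^n`),
and the decoder reproduces `Y^n`. -/
structure Code (X Y : Type*) (n : ℕ) (M₀ M₂ : Type*) where
  enc0 : (Fin n → X) → M₀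
  enc2 : (Fin n → Y) → M₂
  dec : M₀ × M₂ → (Fin n → Y)

/-- Error probability of a code when `(X^n, Y^n)` has mass function `p`. -/
def errorProb {X Y : Type*} [Fintype X] [Fintype Y] {n : ℕ} {M₀ M₂ : Type*}
    (Φ : Code X Y n M₀ M₂) (p : (Fin n → X) × (Fin n → Y) → ℝ) : ℝ :=
  prob p {s | Φ.dec (Φ.enc0 s.1, Φ.enc2 s.2) ≠ s.2}

/-! ### The relaxed rate region -/

/-- The joint law of `((X, Y), W)` where `(X, Y)` has law `P` and `W` is the output of the test
channel `V = P_{W|XY}` with input `(X, Y)`. -/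
def channelLaw {X Y W : Type*} (P : X × Y → ℝ) (V : X × Y → W → ℝ) : (X × Y) × W → ℝ :=
  fun ω => P ω.1 * V ω.1 ω.2

/-- The relaxed region: rate pairs `(r₀, r₂)` for which some test channel `P_{W|XY}` with
`|W| ≤ |X||Y| + 2` satisfies `r₀ ≥ I(W ∧ X,Y)`, `r₂ ≥ H(Y|W)` and `δ ≥ I(W ∧ Y | X)`. -/
def relaxedRegion {X Y : Type*} [Fintype X] [Fintype Y] (δ : ℝ) (P : X × Y → ℝ) : Set (ℝ × ℝ) :=
  {r | ∃ k : ℕ, k ≤ Fintype.card X * Fintype.card Y + 2 ∧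
    ∃ V : X × Y → Fin k → ℝ, (∀ xy, V xy ∈ stdSimplex ℝ (Fin k)) ∧
      mutualInfo (channelLaw P V) (fun ω => ω.2) (fun ω => ω.1) ≤ r.1 ∧
      condEntropy (channelLaw P V) (fun ω => ω.1.2) (fun ω => ω.2) ≤ r.2 ∧
      condMutualInfo (channelLaw P V) (fun ω => ω.2) (fun ω => ω.1.2) (fun ω => ω.1.1) ≤ δ}

/-! ### The quantities in the bound -/

/-- `Δ_n = (|X|(|Y| + 1) + 3) log (n + 1) / n`. -/
def Delta (X Y : Type*) [Fintype X] [Fintype Y] (n : ℕ) : ℝ :=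
  ((Fintype.card X : ℝ) * ((Fintype.card Y : ℝ) + 1) + 3) * Real.logb 2 ((n : ℝ) + 1) / n

/-- The helper's rate with penalty,
`(1/n) log |M₀| + Δ_n + (log log |X| + 2) / n`. -/
def rate0 (X Y M₀ : Type*) [Fintype X] [Fintype Y] [Fintype M₀] (n : ℕ) : ℝ :=
  1 / (n : ℝ) * Real.logb 2 (Fintype.card M₀) + Delta X Y n +
    (Real.logb 2 (Real.logb 2 (Fintype.card X)) + 2) / n

/-- The main encoder's rate with penalty, `(1/n) log |M₂| + (1 + log |Y|) / n`. -/
def rate2 (Y M₂ : Type*) [Fintype Y] [Fintype M₂] (n : ℕ) : ℝ :=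
  1 / (n : ℝ) * Real.logb 2 (Fintype.card M₂) + (1 + Real.logb 2 (Fintype.card Y)) / n

/-- `δ_n = Δ_n + (log log |X| + 3 + log |X|) / n`. -/
def delta (X Y : Type*) [Fintype X] [Fintype Y] (n : ℕ) : ℝ :=
  Delta X Y n +
    (Real.logb 2 (Real.logb 2 (Fintype.card X)) + 3 + Real.logb 2 (Fintype.card X)) / n

/-- The set `E_n` of types `Q` on `X` of length `n` with
`H(Q) ≥ (1/n) log |M₀| + |X| log (n + 1) / n`. -/
def typeSet (X M₀ : Type*) [Fintype X] [Fintype M₀] (n : ℕ) : Set (X → ℝ) :=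
  {Q | (∃ x : Fin n → X, type x = Q) ∧
    1 / (n : ℝ) * Real.logb 2 (Fintype.card M₀) +
      (Fintype.card X : ℝ) * Real.logb 2 ((n : ℝ) + 1) / n ≤ entropy Q}

end WAK

end

/-! Under the i.i.d. law all pairs of sequences of one joint type are equally likely, so it suffices
to treat one joint type class at a time: if the rate pair lies outside the relaxed region of that
type, at most a fraction 1/n of the class is decoded correctly (`mul_card_correct_le`). Summing the
resulting error over the bad types gives the bound.

Suppose instead that the set A of correctly decoded pairs in a class of type Q exceeds that
fraction. By the lower bound on the size of type classes, log |A| ≥ n H(Q) - O(log n). Put the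
uniform law on A, let U be the helper's message, W_i = (U, the letters (X_j, Y_j) with j < i), and
use a uniform time index as part of W. Since every member of A has type exactly Q, the time-averaged
law of (X_i, Y_i) is Q itself. The chain rule gives H(X,Y|W) ≥ (log |A| - log |M₀|)/n. Correct
decoding makes Y^n a function of the two messages, so H(Y|W) ≤ log |M₂|/n. Finally H(Y|X,W) ≥
H(Y^n|X^n)/n ≥ (log |A| - n H(Q_X))/n. These are the three constraints of the region
(`mem_relaxedRegion_of_correct`), up to the size of W.

The size of W is cut to |X||Y| + 2 by linear algebra (`exists_sparse_weight`): as functionals of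
unnormalised slices the information quantities are homogeneous, so reweighting slices acts linearly
on them. -/

noncomputable section

namespace WAK

/-! ### Entropies of random variables -/

/-- The summand `-t log t` of the entropy in bits. -/
def eta (t : ℝ) : ℝ := -(t * Real.logb 2 t)

@[simp] lemma eta_zero : eta 0 = 0 := by simp [eta]

/-- This product rule makes the conditional entropies of unnormalised slices homogeneous of degree
one. -/
lemma eta_mul (t u : ℝ) : eta (t * u) = t * eta u + u * eta t := by
  rcases eq_or_ne t 0 with rfl | ht
  · simp
  rcases eq_or_ne u 0 with rfl | hu
  · simp
  simp only [eta, Real.logb_mul ht hu]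
  ring

lemma entropy_eq_sum_eta {α : Type*} [Fintype α] (q : α → ℝ) : entropy q = ∑ a, eta (q a) := by
  simp [entropy, eta]

section

variable {Ω α β γ : Type*} [Fintype Ω] {p : Ω → ℝ}

open Classical in
lemma prob_eq_sum (p : Ω → ℝ) (A : Set Ω) : prob p A = ∑ ω with ω ∈ A, p ω := by
  simp [prob, Set.indicator_apply, Finset.sum_filter]

open Classical in
lemma law_apply (p : Ω → ℝ) (f : Ω → α) (a : α) : law p f a = ∑ ω with f ω = a, p ω := by
  simp [law, prob_eq_sum]

lemma law_nonneg (hp : ∀ ω, 0 ≤ p ω) (f : Ω → α) (a : α) : 0 ≤ law p f a := by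
  classical
  rw [law_apply]
  exact Finset.sum_nonneg fun _ _ => hp _

lemma sum_law_mul [Fintype α] (p : Ω → ℝ) (f : Ω → α) (u : α → ℝ) :
    ∑ a, law p f a * u a = ∑ ω, p ω * u (f ω) := by
  classical
  simp_rw [law_apply, Finset.sum_mul]
  rw [← Finset.sum_fiberwise Finset.univ f]
  refine Finset.sum_congr rfl fun a _ => Finset.sum_congr rfl fun ω hω => ?_
  rw [(Finset.mem_filter.mp hω).2]

lemma sum_law [Fintype α] (p : Ω → ℝ) (f : Ω → α) : ∑ a, law p f a = ∑ ω, p ω := by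
  simpa using sum_law_mul p f fun _ => 1

lemma law_law [Fintype α] (p : Ω → ℝ) (f : Ω → α) (φ : α → β) :
    law (law p f) φ = law p (fun ω => φ (f ω)) := by
  classical
  funext b
  have := sum_law_mul p f fun a => if φ a = b then 1 else 0
  simpa [law_apply (law p f), law_apply p (fun ω => φ (f ω)), Finset.sum_filter] using this

lemma law_id (p : Ω → ℝ) : law p (fun ω => ω) = p := by
  classical
  funext a
  simp [law_apply, Finset.sum_filter]

lemma law_fst [Fintype β] (p : Ω → ℝ) (f : Ω → α) (g : Ω → β) (a : α) :
    law p f a = ∑ b, law p (fun ω => (f ω, g ω)) (a, b) := by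
  classical
  simp_rw [law_apply]
  rw [← Finset.sum_fiberwise _ g]
  simp [Finset.filter_filter]

lemma law_snd [Fintype α] (p : Ω → ℝ) (f : Ω → α) (g : Ω → β) (b : β) :
    law p g b = ∑ a, law p (fun ω => (f ω, g ω)) (a, b) := by
  classical
  simp_rw [law_apply]
  rw [← Finset.sum_fiberwise _ f]
  simp [Finset.filter_filter, and_comm]

/-- The entropy of a random variable. -/
def ent [Fintype α] (p : Ω → ℝ) (f : Ω → α) : ℝ := entropy (law p f)

/-- Written as an expectation over Ω, entropy identities become pointwise: a point of positive mass
makes every law positive there (`le_law`), so logarithms of quotients split; null points contribute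
nothing. -/
lemma ent_eq_sum [Fintype α] (p : Ω → ℝ) (f : Ω → α) :
    ent p f = -∑ ω, p ω * Real.logb 2 (law p f (f ω)) := by
  rw [ent, entropy, sum_law_mul p f fun a => Real.logb 2 (law p f a)]

lemma le_law (hp : ∀ ω, 0 ≤ p ω) (f : Ω → α) (ω : Ω) : p ω ≤ law p f (f ω) := by
  classical
  rw [law_apply]
  exact Finset.single_le_sum (f := p) (fun _ _ => hp _) (by simp)

lemma law_le_law_comp (hp : ∀ ω, 0 ≤ p ω) (f : Ω → α) (φ : α → β) (a : α) :
    law p f a ≤ law p (fun ω => φ (f ω)) (φ a) := by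
  classical
  simp_rw [law_apply]
  refine Finset.sum_le_sum_of_subset_of_nonneg ?_ fun _ _ _ => hp _
  intro ω
  simp +contextual

/-- A function of a random variable has at most its entropy. -/
lemma ent_comp_le [Fintype α] [Fintype β] (hp : ∀ ω, 0 ≤ p ω) (f : Ω → α) (φ : α → β) :
    ent p (fun ω => φ (f ω)) ≤ ent p f := by
  rw [ent_eq_sum, ent_eq_sum, neg_le_neg_iff]
  refine Finset.sum_le_sum fun ω _ => ?_
  rcases (hp ω).eq_or_lt with h | h
  · simp [← h]
  · exact mul_le_mul_of_nonneg_left (Real.logb_le_logb_of_le one_lt_two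
      (h.trans_le (le_law hp f ω)) (law_le_law_comp hp f φ _)) h.le

/-- Random variables that induce the same partition have the same entropy. -/
lemma ent_congr [Fintype α] [Fintype β] (p : Ω → ℝ) {f : Ω → α} {g : Ω → β}
    (h : ∀ ω ω', f ω = f ω' ↔ g ω = g ω') : ent p f = ent p g := by
  classical
  simp_rw [ent_eq_sum, law_apply, h]

lemma sub_le_mul_log_div {x y : ℝ} (hx : 0 ≤ x) (hy : 0 ≤ y) (h : y = 0 → x = 0) :
    x - y ≤ x * Real.log (x / y) := by
  rcases hx.eq_or_lt with rfl | hx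
  · simpa using hy
  have hy : 0 < y := hy.lt_of_ne fun e => hx.ne' (h e.symm)
  have := Real.one_sub_inv_le_log_of_pos (div_pos hx hy)
  have h2 := mul_le_mul_of_nonneg_left this hx.le
  rw [inv_div] at h2
  calc x - y = x * (1 - y / x) := by field_simp
    _ ≤ _ := h2

/-- Gibbs' inequality. -/
lemma sum_mul_logb_div_nonneg [Fintype α] {q r : α → ℝ} (hq : ∀ a, 0 ≤ q a) (hr : ∀ a, 0 ≤ r a)
    (h : ∀ a, r a = 0 → q a = 0) (hs : ∑ a, r a ≤ ∑ a, q a) :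
    0 ≤ ∑ a, q a * Real.logb 2 (q a / r a) := by
  have : 0 ≤ ∑ a, q a * Real.log (q a / r a) := by
    calc 0 ≤ ∑ a, (q a - r a) := by simpa using hs
      _ ≤ _ := Finset.sum_le_sum fun a _ => sub_le_mul_log_div (hq a) (hr a) (h a)
  simp only [Real.logb, ← mul_div_assoc, ← Finset.sum_div]
  exact div_nonneg this (Real.log_nonneg one_le_two)

lemma condEntropy_eq [Fintype α] [Fintype β] (hp : ∀ ω, 0 ≤ p ω) (f : Ω → α) (g : Ω → β) :
    condEntropy p f g = ent p (fun ω => (f ω, g ω)) - ent p g := by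
  rw [condEntropy, ← Fintype.sum_prod_type', ent_eq_sum, ent_eq_sum]
  simp only [Prod.mk.eta]
  rw [sum_law_mul p (fun ω => (f ω, g ω)) fun ab =>
    Real.logb 2 (law p (fun ω => (f ω, g ω)) ab / law p g ab.2), neg_sub_neg,
    ← Finset.sum_sub_distrib, ← Finset.sum_neg_distrib]
  refine Finset.sum_congr rfl fun ω _ => ?_
  rcases (hp ω).eq_or_lt with h | h
  · simp [← h]
  · rw [Real.logb_div (h.trans_le (le_law hp _ ω)).ne' (h.trans_le (le_law hp _ ω)).ne']
    ring

lemma mutualInfo_eq [Fintype α] [Fintype β] (hp : ∀ ω, 0 ≤ p ω) (f : Ω → α) (g : Ω → β) :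
    mutualInfo p f g = ent p f + ent p g - ent p (fun ω => (f ω, g ω)) := by
  rw [mutualInfo, ← Fintype.sum_prod_type', ent_eq_sum, ent_eq_sum, ent_eq_sum]
  simp only [Prod.mk.eta]
  rw [sum_law_mul p (fun ω => (f ω, g ω)) fun ab =>
    Real.logb 2 (law p (fun ω => (f ω, g ω)) ab / (law p f ab.1 * law p g ab.2)), sub_neg_eq_add,
    ← neg_add, ← Finset.sum_add_distrib, ← Finset.sum_neg_distrib, ← Finset.sum_add_distrib]
  refine Finset.sum_congr rfl fun ω _ => ?_
  rcases (hp ω).eq_or_lt with h | h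
  · simp [← h]
  · have hf := (h.trans_le (le_law hp f ω)).ne'
    have hg := (h.trans_le (le_law hp g ω)).ne'
    rw [Real.logb_div (h.trans_le (le_law hp _ ω)).ne' (mul_ne_zero hf hg), Real.logb_mul hf hg]
    ring

lemma condMutualInfo_eq [Fintype α] [Fintype β] [Fintype γ] (hp : ∀ ω, 0 ≤ p ω)
    (f : Ω → α) (g : Ω → β) (h : Ω → γ) :
    condMutualInfo p f g h = ent p (fun ω => (f ω, h ω)) + ent p (fun ω => (g ω, h ω))
      - ent p (fun ω => (f ω, g ω, h ω)) - ent p h := by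
  have key : condMutualInfo p f g h = ∑ abc : α × β × γ, law p (fun ω => (f ω, g ω, h ω)) abc *
      Real.logb 2 (law p (fun ω => (f ω, g ω, h ω)) abc * law p h abc.2.2 /
      (law p (fun ω => (f ω, h ω)) (abc.1, abc.2.2) *
        law p (fun ω => (g ω, h ω)) (abc.2.1, abc.2.2))) := by
    simp only [condMutualInfo, Fintype.sum_prod_type]
  rw [key, sum_law_mul p (fun ω => (f ω, g ω, h ω)) fun abc =>
    Real.logb 2 (law p (fun ω => (f ω, g ω, h ω)) abc * law p h abc.2.2 /
      (law p (fun ω => (f ω, h ω)) (abc.1, abc.2.2) *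
        law p (fun ω => (g ω, h ω)) (abc.2.1, abc.2.2)))]
  simp only [ent_eq_sum, ← Finset.sum_neg_distrib, ← Finset.sum_add_distrib,
    ← Finset.sum_sub_distrib]
  refine Finset.sum_congr rfl fun ω _ => ?_
  rcases (hp ω).eq_or_lt with h0 | h0
  · simp [← h0]
  · have h1 := (h0.trans_le (le_law hp (fun ω => (f ω, g ω, h ω)) ω)).ne'
    have h2 := (h0.trans_le (le_law hp h ω)).ne'
    have h3 := (h0.trans_le (le_law hp (fun ω => (f ω, h ω)) ω)).ne'
    have h4 := (h0.trans_le (le_law hp (fun ω => (g ω, h ω)) ω)).ne'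
    rw [Real.logb_div (mul_ne_zero h1 h2) (mul_ne_zero h3 h4), Real.logb_mul h1 h2,
      Real.logb_mul h3 h4]
    ring

/-- Gibbs' inequality against the measure p(a,c) p(b,c) / p(c), under which f and g are
conditionally independent given h and which has the same total mass. -/
lemma condMutualInfo_nonneg [Fintype α] [Fintype β] [Fintype γ] (hp : ∀ ω, 0 ≤ p ω)
    (f : Ω → α) (g : Ω → β) (h : Ω → γ) : 0 ≤ condMutualInfo p f g h := by
  have key : condMutualInfo p f g h = ∑ abc : α × β × γ, law p (fun ω => (f ω, g ω, h ω)) abc *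
      Real.logb 2 (law p (fun ω => (f ω, g ω, h ω)) abc /
      (law p (fun ω => (f ω, h ω)) (abc.1, abc.2.2) *
        law p (fun ω => (g ω, h ω)) (abc.2.1, abc.2.2) / law p h abc.2.2)) := by
    simp only [condMutualInfo, Fintype.sum_prod_type, div_div_eq_mul_div]
  rw [key]
  refine sum_mul_logb_div_nonneg (fun _ => law_nonneg hp _ _) (fun _ => div_nonneg
    (mul_nonneg (law_nonneg hp _ _) (law_nonneg hp _ _)) (law_nonneg hp _ _)) ?_ ?_
  · rintro ⟨a, b, c⟩ h0
    refine le_antisymm ?_ (law_nonneg hp _ _)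
    rcases div_eq_zero_iff.mp h0 with h1 | h1
    · rcases mul_eq_zero.mp h1 with h2 | h2
      · exact h2 ▸ law_le_law_comp hp (fun ω => (f ω, g ω, h ω)) (fun t => (t.1, t.2.2)) (a, b, c)
      · exact h2 ▸ law_le_law_comp hp (fun ω => (f ω, g ω, h ω)) (fun t => t.2) (a, b, c)
    · exact h1 ▸ law_le_law_comp hp (fun ω => (f ω, g ω, h ω)) (fun t => t.2.2) (a, b, c)
  · rw [sum_law, ← sum_law p h, ← Fintype.sum_equiv (Equiv.prodAssoc α β γ)
      (fun x => law p (fun ω => (f ω, h ω)) (x.1.1, x.2) *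
        law p (fun ω => (g ω, h ω)) (x.1.2, x.2) / law p h x.2) _ (fun _ => rfl),
      Fintype.sum_prod_type_right]
    refine Finset.sum_le_sum fun c _ => le_of_eq ?_
    rw [Fintype.sum_prod_type]
    simp only [← Finset.sum_div, ← Finset.sum_mul_sum, ← law_snd]
    rcases eq_or_ne (law p h c) 0 with e | e
    · simp [e]
    · field_simp

/-- Conditioning on more reduces conditional entropy. -/
lemma ent_sub_ent_le [Fintype α] [Fintype β] [Fintype γ] (hp : ∀ ω, 0 ≤ p ω)
    (f : Ω → α) (g : Ω → β) {h : Ω → γ} (φ : β → γ) (hφ : ∀ ω, φ (g ω) = h ω) :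
    ent p (fun ω => (f ω, g ω)) - ent p g ≤ ent p (fun ω => (f ω, h ω)) - ent p h := by
  have h1 := condMutualInfo_nonneg hp f g h
  rw [condMutualInfo_eq hp] at h1
  have hgh : ∀ ω ω', g ω = g ω' → h ω = h ω' := fun ω ω' e => by rw [← hφ, ← hφ, e]
  have h2 : ent p (fun ω => (f ω, g ω, h ω)) = ent p (fun ω => (f ω, g ω)) :=
    ent_congr p fun ω ω' => by
      simp only [Prod.mk.injEq]
      exact ⟨fun e => ⟨e.1, e.2.1⟩, fun e => ⟨e.1, e.2, hgh _ _ e.2⟩⟩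
  have h3 : ent p (fun ω => (g ω, h ω)) = ent p g :=
    ent_congr p fun ω ω' => by
      simp only [Prod.mk.injEq]
      exact ⟨fun e => e.1, fun e => ⟨e, hgh _ _ e⟩⟩
  linarith

lemma ent_of_subsingleton [Fintype α] [Subsingleton α] (hs : ∑ ω, p ω = 1) (f : Ω → α) :
    ent p f = 0 := by
  classical
  rw [ent_eq_sum]
  have : ∀ ω, law p f (f ω) = 1 := fun ω => by
    rw [law_apply, ← hs]
    congr 1
    ext; simp [eq_iff_true_of_subsingleton]
  simp [this]

lemma ent_prod_le [Fintype α] [Fintype β] (hp : ∀ ω, 0 ≤ p ω) (hs : ∑ ω, p ω = 1)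
    (f : Ω → α) (g : Ω → β) : ent p (fun ω => (f ω, g ω)) ≤ ent p f + ent p g := by
  have := ent_sub_ent_le hp f g (h := fun _ => ()) (fun _ => ()) (fun _ => rfl)
  rw [ent_of_subsingleton hs fun _ => (), ent_congr p (f := fun ω => (f ω, ())) (g := f)
    (by simp)] at this
  linarith

open Classical in
/-- A random variable with values in a finite set has at most the entropy of the uniform law. -/
lemma ent_le_logb_card [Fintype α] (hp : ∀ ω, 0 ≤ p ω) (hs : ∑ ω, p ω = 1) (f : Ω → α)
    (S : Finset α) (hS : ∀ ω, f ω ∈ S) : ent p f ≤ Real.logb 2 S.card := by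
  have hne : Nonempty Ω := by
    by_contra h
    rw [not_nonempty_iff] at h
    simp at hs
  have hc : (0 : ℝ) < S.card := by
    obtain ⟨ω⟩ := hne
    exact_mod_cast Finset.card_pos.mpr ⟨_, hS ω⟩
  have hz : ∀ a, a ∉ S → law p f a = 0 := fun a ha => by
    rw [law_apply]
    exact Finset.sum_eq_zero fun ω hω => absurd ((Finset.mem_filter.mp hω).2 ▸ hS ω) ha
  -- Gibbs' inequality against the uniform law on `S`.
  have h := sum_mul_logb_div_nonneg (q := law p f) (r := fun a => if a ∈ S then 1 / (S.card : ℝ) else 0)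
    (law_nonneg hp f) (fun a => by split_ifs <;> positivity) (fun a ha => ?_) ?_
  · rw [sum_law_mul p f fun a => Real.logb 2 (law p f a / if a ∈ S then 1 / (S.card : ℝ) else 0)] at h
    have : ∀ ω, p ω * Real.logb 2 (law p f (f ω) / if f ω ∈ S then 1 / (S.card : ℝ) else 0) =
        p ω * Real.logb 2 (law p f (f ω)) + p ω * Real.logb 2 S.card := fun ω => by
      rcases (hp ω).eq_or_lt with h0 | h0
      · simp [← h0]
      · rw [if_pos (hS ω), div_div_eq_mul_div, div_one,
          Real.logb_mul (h0.trans_le (le_law hp f ω)).ne' hc.ne']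
        ring
    simp_rw [this] at h
    rw [Finset.sum_add_distrib, ← Finset.sum_mul, hs] at h
    rw [ent_eq_sum]
    linarith
  · by_cases hm : a ∈ S
    · simp [hm, hc.ne'] at ha
    · exact hz a hm
  · rw [sum_law, hs]
    simp [hc.ne']

lemma ent_le_logb_fintype_card [Fintype α] (hp : ∀ ω, 0 ≤ p ω) (hs : ∑ ω, p ω = 1)
    (f : Ω → α) : ent p f ≤ Real.logb 2 (Fintype.card α) :=
  ent_le_logb_card hp hs f Finset.univ fun _ => Finset.mem_univ _

lemma ent_const_of_injective [Fintype α] {c : ℝ} (hc : ∀ ω, p ω = 1 / c)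
    (hcard : (Fintype.card Ω : ℝ) = c) (hc0 : c ≠ 0) {f : Ω → α} (hf : f.Injective) :
    ent p f = Real.logb 2 c := by
  classical
  rw [ent_eq_sum]
  have : ∀ ω, law p f (f ω) = 1 / c := fun ω => by
    rw [law_apply, Finset.sum_eq_single ω] <;> simp +contextual [hc, hf.eq_iff]
  simp only [this, hc, Finset.sum_const, Finset.card_univ, nsmul_eq_mul, hcard]
  rw [one_div, Real.logb_inv]
  field_simp

end

/-! ### Reduction of the support -/

open Classical in
/-- If a nontrivial linear relation annihilates the masses, the weights can be moved along it
until the support shrinks. -/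
lemma exists_weight_of_relation {ι : Type*} [Fintype ι] (M l c : ι → ℝ)
    (hM : ∀ w, l w ≠ 0 → 0 < M w) (hl : ∀ w, 0 ≤ l w) (hc : c ≠ 0)
    (hcl : ∀ w, l w = 0 → c w = 0) (hcM : ∑ w, c w * M w = 0) :
    ∃ t : ℝ, 0 ≤ t ∧ (∀ w, 0 ≤ l w + t * c w) ∧
      (Finset.univ.filter fun w => l w + t * c w ≠ 0) ⊂ Finset.univ.filter fun w => l w ≠ 0 := by
  -- A nonzero relation that cancels against positive masses must take a negative value.
  have hneg : ∃ w, c w < 0 := by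
    by_contra! h
    refine hc (funext fun w => ?_)
    by_cases hw : l w = 0
    · exact hcl w hw
    · have h0 : ∀ v, 0 ≤ c v * M v := fun v => by
        by_cases hv : l v = 0
        · simp [hcl v hv]
        · exact mul_nonneg (h v) (hM v hv).le
      have := (Finset.sum_eq_zero_iff_of_nonneg fun v _ => h0 v).mp hcM w (Finset.mem_univ _)
      exact (mul_eq_zero.mp this).resolve_right (hM w hw).ne'
  obtain ⟨w₀, hw₀⟩ := hneg
  -- The smallest ratio is the largest step that keeps all weights nonnegative; the weight at its
  -- minimiser drops to zero.
  obtain ⟨v, hv, hmin⟩ := Finset.exists_min_image (Finset.univ.filter fun w => c w < 0)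
    (fun w => l w / -c w) ⟨w₀, by simp [hw₀]⟩
  have hv : c v < 0 := by simpa using hv
  refine ⟨l v / -c v, div_nonneg (hl v) (by linarith), fun w => ?_, ?_⟩
  · by_cases hw : c w < 0
    · have := hmin w (by simp [hw])
      rw [le_div_iff₀ (by linarith)] at this
      linarith
    · have := mul_nonneg (div_nonneg (hl v) (by linarith : 0 ≤ -c v)) (not_lt.mp hw)
      linarith [hl w]
  · refine (Finset.ssubset_iff_of_subset ?_).mpr ⟨v, ?_, ?_⟩
    · intro w
      simp only [Finset.mem_filter, Finset.mem_univ, true_and]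
      intro h h0
      exact h (by simp [h0, hcl w h0])
    · simpa using fun h => hv.ne (hcl v h)
    · have : l v + l v / -c v * c v = 0 := by
        rw [div_neg, neg_mul, div_mul_cancel₀ _ hv.ne, add_neg_cancel]
      simp [this]

open Classical in
/-- A finite family of nonnegative measures can be reweighted so that few weights survive, the
total measure and two linear functionals are preserved, and a third one does not increase. -/
lemma exists_sparse_weight {ι κ : Type*} [Fintype ι] [Fintype κ] (m : ι → κ → ℝ)
    (hm : ∀ w a, 0 ≤ m w a) (F₁ F₂ F₃ : ι → ℝ)
    (h0 : ∀ w, m w = 0 → F₁ w = 0 ∧ F₂ w = 0 ∧ F₃ w = 0) :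
    ∃ l : ι → ℝ, (∀ w, 0 ≤ l w) ∧
      (Finset.univ.filter fun w => l w ≠ 0).card ≤ Fintype.card κ + 2 ∧
      (∀ a, ∑ w, l w * m w a = ∑ w, m w a) ∧ ∑ w, l w * F₁ w = ∑ w, F₁ w ∧
      ∑ w, l w * F₂ w = ∑ w, F₂ w ∧ ∑ w, l w * F₃ w ≤ ∑ w, F₃ w := by
  -- Among all admissible weights one of minimal support is taken. Requiring null measures to carry
  -- no weight ensures positive mass on the support.
  let good : (ι → ℝ) → Prop := fun l => (∀ w, 0 ≤ l w) ∧ (∀ w, l w ≠ 0 → m w ≠ 0) ∧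
      (∀ a, ∑ w, l w * m w a = ∑ w, m w a) ∧ ∑ w, l w * F₁ w = ∑ w, F₁ w ∧
      ∑ w, l w * F₂ w = ∑ w, F₂ w ∧ ∑ w, l w * F₃ w ≤ ∑ w, F₃ w
  let size : (ι → ℝ) → ℕ := fun l => (Finset.univ.filter fun w => l w ≠ 0).card
  have hex : ∃ k l, good l ∧ size l = k := by
    refine ⟨_, fun w => if m w = 0 then 0 else 1, ⟨fun w => ?_, fun w => ?_, fun a => ?_, ?_, ?_,
      le_of_eq ?_⟩, rfl⟩
    · dsimp only
      split_ifs <;> simp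
    · simp
    all_goals
      refine Finset.sum_congr rfl fun w _ => ?_
      by_cases h : m w = 0
      · simp [h, h0 w h]
      · simp [h]
  obtain ⟨l, hl, hlk⟩ := Nat.find_spec hex
  obtain ⟨hl0, hlm, hla, hl1, hl2, hl3⟩ := hl
  refine ⟨l, hl0, ?_, hla, hl1, hl2, hl3⟩
  by_contra! hlt
  let S := Finset.univ.filter fun w => l w ≠ 0
  -- A larger support gives more vectors (m w, F₁ w, F₂ w) than the dimension |κ| + 2 allows.
  have hdep : ¬ LinearIndependent ℝ
      (fun w : S => (Sum.elim (m w) ![F₁ w, F₂ w] : κ ⊕ Fin 2 → ℝ)) := fun hli => by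
    have := hli.fintype_card_le_finrank
    simp only [Module.finrank_fintype_fun_eq_card, Fintype.card_sum, Fintype.card_fin,
      Fintype.card_coe] at this
    exact absurd this (not_le.mpr hlt)
  rw [Fintype.not_linearIndependent_iff] at hdep
  obtain ⟨g, hg, v, hv⟩ := hdep
  let d : ι → ℝ := fun w => if h : w ∈ S then g ⟨w, h⟩ else 0
  have hsum : ∀ u : ι → ℝ, ∑ w, d w * u w = ∑ w : S, g w * u w := fun u => by
    rw [← Finset.sum_subset (Finset.subset_univ S) (fun w _ hw => by simp [d, hw]),
      ← Finset.sum_coe_sort S]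
    exact Finset.sum_congr rfl fun w _ => by simp [d]
  have hda : ∀ a, ∑ w, d w * m w a = 0 := fun a => by
    simpa [hsum] using congrFun hg (Sum.inl a)
  have hd1 : ∑ w, d w * F₁ w = 0 := by simpa [hsum] using congrFun hg (Sum.inr 0)
  have hd2 : ∑ w, d w * F₂ w = 0 := by simpa [hsum] using congrFun hg (Sum.inr 1)
  have hd : d ≠ 0 := fun h => hv (by simpa [d] using congrFun h v)
  have hdl : ∀ w, l w = 0 → d w = 0 := fun w hw => by simp [d, S, hw]
  -- The third functional needs no extra dimension: the sign of the relation is chosen so that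
  -- moving along it does not increase F₃.
  obtain ⟨c, hc, hcl, hca, hc1, hc2, hc3⟩ : ∃ c : ι → ℝ, c ≠ 0 ∧ (∀ w, l w = 0 → c w = 0) ∧
      (∀ a, ∑ w, c w * m w a = 0) ∧ ∑ w, c w * F₁ w = 0 ∧ ∑ w, c w * F₂ w = 0 ∧
      ∑ w, c w * F₃ w ≤ 0 := by
    rcases le_total (∑ w, d w * F₃ w) 0 with h | h
    · exact ⟨d, hd, hdl, hda, hd1, hd2, h⟩
    · exact ⟨-d, neg_ne_zero.mpr hd, fun w hw => by simp [hdl w hw], fun a => by simp [hda],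
        by simp [hd1], by simp [hd2], by simpa using h⟩
  obtain ⟨t, ht, hnn, hss⟩ := exists_weight_of_relation (fun w => ∑ a, m w a) l c
    (fun w hw => (Finset.sum_nonneg fun a _ => hm w a).lt_of_ne fun h => hlm w hw
      (funext fun a => (Finset.sum_eq_zero_iff_of_nonneg fun a _ => hm w a).mp h.symm a
        (Finset.mem_univ a))) hl0 hc hcl
    (by simp_rw [Finset.mul_sum]; rw [Finset.sum_comm]; simp [hca])
  have hadd : ∀ u : ι → ℝ, ∑ w, (l w + t * c w) * u w = ∑ w, l w * u w + t * ∑ w, c w * u w :=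
    fun u => by simp [add_mul, Finset.sum_add_distrib, Finset.mul_sum, mul_assoc]
  have hgood : good fun w => l w + t * c w := by
    refine ⟨hnn, fun w hw => hlm w fun h => hw (by simp [h, hcl w h]), fun a => ?_, ?_, ?_, ?_⟩
    · rw [hadd fun w => m w a, hca, hla]; simp
    · rw [hadd, hc1, hl1]; simp
    · rw [hadd, hc2, hl2]; simp
    · rw [hadd]
      nlinarith
  have := Nat.find_min' hex ⟨_, hgood, rfl⟩
  have h2 := Finset.card_lt_card hss
  simp only [size] at this hlk
  omega

/-! ### Types and type classes -/

section

variable {α : Type*} {n : ℕ}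

open Classical in
/-- The number of occurrences of a letter in a sequence. -/
def count (s : Fin n → α) (a : α) : ℕ := (Finset.univ.filter fun i => s i = a).card

lemma type_eq_count (s : Fin n → α) (a : α) : type s a = count s a / n := by
  classical
  rw [type, count, Set.ncard_eq_toFinset_card']
  simp

lemma count_eq_mul_type (hn : 1 ≤ n) (s : Fin n → α) (a : α) : (count s a : ℝ) = n * type s a := by
  rw [type_eq_count]
  have : (n : ℝ) ≠ 0 := by positivity
  field_simp

lemma type_eq_type_iff (hn : 1 ≤ n) (s t : Fin n → α) : type s = type t ↔ count s = count t := by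
  constructor
  · intro h
    funext a
    have := count_eq_mul_type hn s a
    rw [h, ← count_eq_mul_type hn] at this
    exact_mod_cast this
  · intro h
    funext a
    rw [type_eq_count, type_eq_count, h]

lemma type_nonneg (s : Fin n → α) (a : α) : 0 ≤ type s a := by
  rw [type_eq_count]; positivity

lemma prod_type_pos (s : Fin n → α) : 0 < ∏ i, type s (s i) := by
  classical
  refine Finset.prod_pos fun i _ => ?_
  rw [type_eq_count]
  have : 0 < n := i.pos
  have : 0 < count s (s i) := Finset.card_pos.mpr ⟨i, by simp⟩
  positivity

variable [Fintype α]

lemma sum_count (s : Fin n → α) : ∑ a, count s a = n := by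
  classical
  simp only [count]
  exact (Finset.card_eq_sum_card_fiberwise (s := Finset.univ) (t := Finset.univ) (f := s)
    fun _ _ => Finset.mem_coe.mpr (Finset.mem_univ _)).symm.trans (by simp)

lemma sum_type (hn : 1 ≤ n) (s : Fin n → α) : ∑ a, type s a = 1 := by
  simp_rw [type_eq_count, ← Finset.sum_div]
  rw [← Nat.cast_sum, sum_count, div_self (by positivity)]

lemma prod_comp_eq_prod_pow_count (s : Fin n → α) (z : α → ℝ) :
    ∏ i, z (s i) = ∏ a, z a ^ count s a := by
  classical
  rw [← Finset.prod_fiberwise Finset.univ s]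
  refine Finset.prod_congr rfl fun a _ => ?_
  rw [Finset.prod_congr rfl (g := fun _ => z a) fun i hi => by rw [(Finset.mem_filter.mp hi).2],
    Finset.prod_const, count]

/-- The sequences with the same type as `s`. -/
def typeClass (s : Fin n → α) : Finset (Fin n → α) := by
  classical exact Finset.univ.filter fun t => count t = count s

lemma mem_typeClass {s t : Fin n → α} : t ∈ typeClass s ↔ count t = count s := by
  simp [typeClass]

lemma logb_prod_type (hn : 1 ≤ n) (s : Fin n → α) :
    Real.logb 2 (∏ i, type s (s i)) = -(n * entropy (type s)) := by
  classical
  rw [prod_comp_eq_prod_pow_count, Real.logb_prod, entropy, mul_neg, neg_neg, Finset.mul_sum]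
  · refine Finset.sum_congr rfl fun a _ => ?_
    rw [Real.logb_pow, count_eq_mul_type hn, mul_assoc]
  · intro a _ h
    have := prod_type_pos s
    rw [prod_comp_eq_prod_pow_count, Finset.prod_eq_zero (Finset.mem_univ a) h] at this
    exact lt_irrefl _ this

lemma sum_typeClass_prod (s : Fin n → α) (z : α → ℝ) :
    ∑ t ∈ typeClass s, ∏ i, z (t i) = (typeClass s).card * ∏ i, z (s i) := by
  rw [Finset.sum_congr rfl (g := fun _ => ∏ i, z (s i)), Finset.sum_const, nsmul_eq_mul]
  intro t ht
  rw [prod_comp_eq_prod_pow_count, prod_comp_eq_prod_pow_count, mem_typeClass.mp ht]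

lemma sum_prod_eq_pow (z : α → ℝ) : ∑ t : Fin n → α, ∏ i, z (t i) = (∑ a, z a) ^ n := by
  classical
  rw [← Fintype.piFinset_univ, ← Finset.prod_univ_sum]
  simp

/-- A type class has at most `2 ^ (n H)` elements. -/
lemma logb_card_typeClass_le (hn : 1 ≤ n) (s : Fin n → α) :
    Real.logb 2 (typeClass s).card ≤ n * entropy (type s) := by
  have h1 : (typeClass s).card * ∏ i, type s (s i) ≤ 1 := by
    rw [← sum_typeClass_prod]
    calc _ ≤ ∑ t : Fin n → α, ∏ i, type s (t i) := Finset.sum_le_sum_of_subset_of_nonneg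
          (Finset.subset_univ _) fun _ _ _ => Finset.prod_nonneg fun _ _ => type_nonneg _ _
      _ = 1 := by rw [sum_prod_eq_pow, sum_type hn, one_pow]
  have hc : (0 : ℝ) < (typeClass s).card := by
    exact_mod_cast Finset.card_pos.mpr ⟨s, mem_typeClass.mpr rfl⟩
  have := Real.logb_le_logb_of_le one_lt_two (mul_pos hc (prod_type_pos s)) h1
  rw [Real.logb_mul hc.ne' (prod_type_pos s).ne', logb_prod_type hn, Real.logb_one] at this
  linarith

open Classical in
-- The power (∑ X_a)^n is expanded word by word and by the multinomial theorem; comparing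
-- coefficients counts the class.
lemma card_typeClass_mul_prod_factorial (s : Fin n → α) :
    (typeClass s).card * ∏ a, (count s a).factorial = n.factorial := by
  have hexp : ((∑ a, MvPolynomial.X a : MvPolynomial α ℕ)) ^ n =
      ∑ t : Fin n → α, MvPolynomial.monomial (Finsupp.equivFunOnFinite.symm (count t)) 1 := by
    rw [← Finset.card_fin n, ← Finset.prod_const, Finset.card_fin, Finset.prod_univ_sum,
      Fintype.piFinset_univ]
    refine Finset.sum_congr rfl fun t _ => ?_
    rw [MvPolynomial.monomial_eq, Finsupp.prod_fintype _ _ fun _ => pow_zero _]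
    simp only [map_one, one_mul, Finsupp.equivFunOnFinite_symm_apply_apply]
    rw [← Finset.prod_fiberwise Finset.univ t]
    refine Finset.prod_congr rfl fun a _ => ?_
    rw [Finset.prod_congr rfl (g := fun _ => MvPolynomial.X a) fun i hi => by
      rw [(Finset.mem_filter.mp hi).2], Finset.prod_const, count]
  have hcoeff := MvPolynomial.coeff_sum_X_pow_of_fintype (R := ℕ)
    (Finsupp.equivFunOnFinite.symm (count s)) n
  have hsum : (Finsupp.equivFunOnFinite.symm (count s)).sum (fun _ m => m) = n := by
    rw [Finsupp.sum_fintype _ _ fun _ => rfl]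
    simp [sum_count]
  rw [if_pos hsum, hexp, MvPolynomial.coeff_sum] at hcoeff
  simp only [MvPolynomial.coeff_monomial, EmbeddingLike.apply_eq_iff_eq, Finset.sum_boole,
    Nat.cast_id] at hcoeff
  have hcard : (typeClass s).card = Nat.multinomial Finset.univ (count s) := by
    rw [Finsupp.multinomial_eq_of_support_subset (Finset.subset_univ _)] at hcoeff
    simpa [typeClass] using hcoeff
  rw [hcard, mul_comm, Nat.multinomial_spec, sum_count]

/-- This is k!/a! ≥ a^(k-a), valid for either sign of k - a. Multiplied over letters, it compares
the probabilities of two type classes. -/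
lemma factorial_mul_pow_le (a k : ℕ) : a.factorial * a ^ k ≤ k.factorial * a ^ a := by
  rcases le_total a k with h | h
  · calc a.factorial * a ^ k = a.factorial * a ^ (k - a) * a ^ a := by
          rw [mul_assoc, ← pow_add, Nat.sub_add_cancel h]
      _ ≤ _ := Nat.mul_le_mul_right _ (Nat.factorial_mul_pow_sub_le_factorial h)
  · have h1 : a.factorial ≤ k.factorial * a ^ (a - k) := by
      conv_lhs => rw [← Nat.sub_add_cancel h, add_comm]
      rw [← Nat.factorial_mul_ascFactorial]
      refine Nat.mul_le_mul_left _ ?_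
      simpa [Nat.add_sub_cancel' h] using Nat.ascFactorial_le_pow_add k (a - k)
    calc a.factorial * a ^ k ≤ k.factorial * a ^ (a - k) * a ^ k := Nat.mul_le_mul_right _ h1
      _ = _ := by rw [mul_assoc, ← pow_add, Nat.sub_add_cancel h]

/-- Among all type classes, that of `s` is the most likely one under the type of `s`. -/
lemma card_typeClass_mul_prod_le (s t : Fin n → α) :
    (typeClass t).card * ∏ i, type s (t i) ≤ (typeClass s).card * ∏ i, type s (s i) := by
  have hN : (typeClass t).card * ∏ a, count s a ^ count t a ≤
      (typeClass s).card * ∏ a, count s a ^ count s a := by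
    refine Nat.le_of_mul_le_mul_right ?_
      (Finset.prod_pos fun a (_ : a ∈ Finset.univ) => (count s a).factorial_pos)
    calc (typeClass t).card * (∏ a, count s a ^ count t a) * ∏ a, (count s a).factorial
        = (typeClass t).card * ∏ a, (count s a).factorial * count s a ^ count t a := by
          rw [Finset.prod_mul_distrib]; ring
      _ ≤ (typeClass t).card * ∏ a, (count t a).factorial * count s a ^ count s a :=
          Nat.mul_le_mul_left _ (Finset.prod_le_prod' fun a _ => factorial_mul_pow_le _ _)
      _ = ((typeClass t).card * ∏ a, (count t a).factorial) * ∏ a, count s a ^ count s a := by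
          rw [Finset.prod_mul_distrib]; ring
      _ = _ := by
          rw [card_typeClass_mul_prod_factorial t, ← card_typeClass_mul_prod_factorial s]; ring
  have hR : ∀ r : Fin n → α,
      ∏ i, type s (r i) = ((∏ a, count s a ^ count r a : ℕ) : ℝ) / (n : ℝ) ^ n := fun r => by
    simp_rw [type_eq_count, Finset.prod_div_distrib]
    rw [prod_comp_eq_prod_pow_count r fun a => (count s a : ℝ)]
    simp
  rw [hR, hR, ← mul_div_assoc, ← mul_div_assoc]
  exact div_le_div_of_nonneg_right (by exact_mod_cast hN) (by positivity)

/-- A type class has at least `2 ^ (n H) / (n + 1) ^ |α|` elements. -/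
lemma le_logb_card_typeClass (hn : 1 ≤ n) (s : Fin n → α) :
    n * entropy (type s) - Fintype.card α * Real.logb 2 (n + 1) ≤
      Real.logb 2 (typeClass s).card := by
  classical
  have hc : (0 : ℝ) < (typeClass s).card := by
    exact_mod_cast Finset.card_pos.mpr ⟨s, mem_typeClass.mpr rfl⟩
  have hmaps : ∀ t ∈ (Finset.univ : Finset (Fin n → α)), count t ∈
      Fintype.piFinset fun _ : α => Finset.range (n + 1) := fun t _ => by
    simp only [Fintype.mem_piFinset, Finset.mem_range]
    intro a
    have := Finset.single_le_sum (f := count t) (fun _ _ => Nat.zero_le _) (Finset.mem_univ a)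
    rw [sum_count] at this
    omega
  -- There are at most (n+1)^|α| count vectors, and no class is more likely than that of `s`.
  have h1 : (1 : ℝ) ≤ ((n : ℝ) + 1) ^ Fintype.card α *
      ((typeClass s).card * ∏ i, type s (s i)) := by
    calc (1 : ℝ) = ∑ t : Fin n → α, ∏ i, type s (t i) := by
          rw [sum_prod_eq_pow, sum_type hn, one_pow]
      _ = ∑ k ∈ Fintype.piFinset fun _ : α => Finset.range (n + 1),
            ∑ t with count t = k, ∏ i, type s (t i) :=
          (Finset.sum_fiberwise_of_maps_to hmaps _).symm
      _ ≤ ∑ k ∈ Fintype.piFinset fun _ : α => Finset.range (n + 1),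
            (typeClass s).card * ∏ i, type s (s i) := by
          refine Finset.sum_le_sum fun k _ => ?_
          rcases (Finset.univ.filter fun t : Fin n → α => count t = k).eq_empty_or_nonempty
            with h | ⟨t, ht⟩
          · rw [h, Finset.sum_empty]
            exact mul_nonneg hc.le (prod_type_pos s).le
          · have ht : count t = k := (Finset.mem_filter.mp ht).2
            calc _ = ∑ r ∈ typeClass t, ∏ i, type s (r i) :=
                  Finset.sum_congr (by ext; simp [mem_typeClass, ht]) fun _ _ => rfl
              _ ≤ _ := by
                rw [sum_typeClass_prod]
                exact card_typeClass_mul_prod_le s t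
      _ = _ := by simp
  have hpow : (0 : ℝ) < ((n : ℝ) + 1) ^ Fintype.card α := by positivity
  have h2 := Real.logb_nonneg one_lt_two h1
  rw [Real.logb_mul hpow.ne' (mul_pos hc (prod_type_pos s)).ne',
    Real.logb_mul hc.ne' (prod_type_pos s).ne', logb_prod_type hn, Real.logb_pow] at h2
  linarith

end

/-! ### Entropy functionals of unnormalised measures -/

section

variable {X Y W Ω : Type*} [Fintype X] [Fintype Y] [Fintype W] [Fintype Ω]

/-- The contribution of an unnormalised slice to `H(X, Y | W)`. -/
def jointFun (m : X × Y → ℝ) : ℝ := entropy m - eta (∑ a, m a)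

/-- The contribution of an unnormalised slice to `H(Y | W)`. -/
def sndFun (m : X × Y → ℝ) : ℝ := entropy (law m Prod.snd) - eta (∑ a, m a)

/-- The contribution of an unnormalised slice to `H(Y | X, W)`. -/
def condFun (m : X × Y → ℝ) : ℝ := entropy m - entropy (law m Prod.fst)

lemma entropy_mul (t : ℝ) (q : W → ℝ) :
    entropy (fun a => t * q a) = t * entropy q + (∑ a, q a) * eta t := by
  simp_rw [entropy_eq_sum_eta, eta_mul, Finset.sum_add_distrib, Finset.mul_sum, Finset.sum_mul]

lemma law_mul {α β : Type*} [Fintype α] (t : ℝ) (q : α → ℝ) (f : α → β) :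
    law (fun a => t * q a) f = fun b => t * law q f b := by
  classical
  funext b
  simp_rw [law_apply, Finset.mul_sum]

lemma jointFun_mul (t : ℝ) (m : X × Y → ℝ) : jointFun (fun a => t * m a) = t * jointFun m := by
  rw [jointFun, jointFun, entropy_mul, ← Finset.mul_sum, eta_mul]
  ring

lemma sndFun_mul (t : ℝ) (m : X × Y → ℝ) : sndFun (fun a => t * m a) = t * sndFun m := by
  rw [sndFun, sndFun, law_mul, entropy_mul, ← Finset.mul_sum, eta_mul, sum_law]
  ring

lemma condFun_mul (t : ℝ) (m : X × Y → ℝ) : condFun (fun a => t * m a) = t * condFun m := by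
  rw [condFun, condFun, law_mul, entropy_mul, entropy_mul, sum_law]
  ring

/-- The unnormalised law of `f` on the event `g = w`. -/
def slice (p : Ω → ℝ) (f : Ω → X × Y) (g : Ω → W) (w : W) : X × Y → ℝ :=
  fun a => law p (fun ω => (f ω, g ω)) (a, w)

lemma law_slice {α : Type*} (p : Ω → ℝ) (f : Ω → X × Y) (g : Ω → W) (w : W) (φ : X × Y → α) :
    law (slice p f g w) φ = fun b => law p (fun ω => (φ (f ω), g ω)) (b, w) := by
  classical
  funext b
  rw [← law_law p (fun ω => (f ω, g ω)) fun t => (φ t.1, t.2), law_apply, law_apply]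
  simp only [Prod.mk.injEq, Finset.sum_filter, Fintype.sum_prod_type_right (α₁ := X × Y)]
  rw [Finset.sum_eq_single w] <;> simp +contextual [slice]

lemma sum_entropy_slice {α : Type*} [Fintype α] (p : Ω → ℝ) (f : Ω → α) (g : Ω → W) :
    ∑ w, entropy (fun a => law p (fun ω => (f ω, g ω)) (a, w)) = ent p (fun ω => (f ω, g ω)) := by
  simp_rw [ent, entropy_eq_sum_eta, Fintype.sum_prod_type_right]

lemma sum_eta_slice (p : Ω → ℝ) (f : Ω → X × Y) (g : Ω → W) :
    ∑ w, eta (∑ a, slice p f g w a) = ent p g := by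
  simp_rw [ent, entropy_eq_sum_eta, law_snd p f g, slice]

lemma sum_jointFun_slice (p : Ω → ℝ) (f : Ω → X × Y) (g : Ω → W) :
    ∑ w, jointFun (slice p f g w) = ent p (fun ω => (f ω, g ω)) - ent p g := by
  simp_rw [jointFun, Finset.sum_sub_distrib, sum_eta_slice, ← sum_entropy_slice]
  rfl

lemma sum_sndFun_slice (p : Ω → ℝ) (f : Ω → X × Y) (g : Ω → W) :
    ∑ w, sndFun (slice p f g w) = ent p (fun ω => ((f ω).2, g ω)) - ent p g := by
  simp_rw [sndFun, Finset.sum_sub_distrib, sum_eta_slice, ← sum_entropy_slice, law_slice]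

lemma sum_condFun_slice (p : Ω → ℝ) (f : Ω → X × Y) (g : Ω → W) :
    ∑ w, condFun (slice p f g w) =
      ent p (fun ω => (f ω, g ω)) - ent p (fun ω => ((f ω).1, g ω)) := by
  simp_rw [condFun, Finset.sum_sub_distrib, law_slice, ← sum_entropy_slice]
  rfl

/-! ### Membership in the relaxed region -/

lemma mem_relaxedRegion_of_channel {k : ℕ} (hk : k ≤ Fintype.card X * Fintype.card Y + 2)
    {Q : X × Y → ℝ} (hQ : ∀ a, 0 ≤ Q a) {V : X × Y → Fin k → ℝ}
    (hV : ∀ a, V a ∈ stdSimplex ℝ (Fin k)) {r : ℝ × ℝ} {δ : ℝ}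
    (h1 : entropy Q - ∑ j, jointFun (fun a => Q a * V a j) ≤ r.1)
    (h2 : ∑ j, sndFun (fun a => Q a * V a j) ≤ r.2)
    (h3 : entropy Q - entropy (law Q Prod.fst) - ∑ j, condFun (fun a => Q a * V a j) ≤ δ) :
    r ∈ relaxedRegion δ Q := by
  set q := channelLaw Q V with hq
  have hq0 : ∀ ω, 0 ≤ q ω := fun ω => mul_nonneg (hQ _) ((hV _).1 _)
  -- The measures Q(·) V(j|·) are the slices of the joint law at W = j, so sums of the functionals
  -- are the conditional entropies given W.
  have hslice : ∀ j, (fun a => Q a * V a j) = slice q (fun ω => ω.1) (fun ω => ω.2) j := fun j => by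
    funext a
    change _ = law q (fun ω => ω) (a, j)
    rw [law_id]
    rfl
  have hfst : law q (fun ω => ω.1) = Q := by
    funext a
    rw [law_fst q (fun ω => ω.1) (fun ω => ω.2)]
    change ∑ j, law q (fun ω => ω) (a, j) = _
    rw [law_id]
    simp only [hq, channelLaw, ← Finset.mul_sum]
    rw [(hV a).2, mul_one]
  have hX : law q (fun ω => ω.1.1) = law Q Prod.fst := by
    rw [← hfst, law_law]
  simp_rw [hslice] at h1 h2 h3
  rw [sum_jointFun_slice] at h1
  rw [sum_sndFun_slice] at h2
  rw [sum_condFun_slice] at h3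
  refine ⟨k, hk, V, hV, le_trans (le_of_eq ?_) h1, le_trans (le_of_eq ?_) h2,
    le_trans (le_of_eq ?_) h3⟩
  · rw [mutualInfo_eq hq0, ent_congr q (f := fun ω : (X × Y) × Fin k => (ω.2, ω.1))
      (g := fun ω => (ω.1, ω.2)) (by simp [and_comm]), ent.eq_def q (fun ω => ω.1), hfst]
    ring
  · rw [condEntropy_eq hq0]
  · rw [condMutualInfo_eq hq0, ent_congr q (f := fun ω : (X × Y) × Fin k => (ω.2, ω.1.2, ω.1.1))
      (g := fun ω => (ω.1, ω.2)) (by simp; tauto),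
      ent_congr q (f := fun ω : (X × Y) × Fin k => (ω.2, ω.1.1)) (g := fun ω => (ω.1.1, ω.2))
      (by simp [and_comm]),
      ent_congr q (f := fun ω : (X × Y) × Fin k => (ω.1.2, ω.1.1)) (g := fun ω => ω.1)
      (by simp; tauto), ent.eq_def q (fun ω => ω.1), hfst, ent.eq_def q (fun ω => ω.1.1), hX]
    ring

/-- A decomposition of `Q` into finitely many measures, however many, yields a test channel of
bounded output size. -/
lemma mem_relaxedRegion_of_decomposition {ι : Type*} [Fintype ι] {Q : X × Y → ℝ}
    (hQ1 : ∑ a, Q a = 1) (m : ι → X × Y → ℝ) (hm : ∀ w a, 0 ≤ m w a)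
    (hmQ : ∀ a, ∑ w, m w a = Q a) {r : ℝ × ℝ} {δ : ℝ}
    (h1 : entropy Q - ∑ w, jointFun (m w) ≤ r.1) (h2 : ∑ w, sndFun (m w) ≤ r.2)
    (h3 : entropy Q - entropy (law Q Prod.fst) - ∑ w, condFun (m w) ≤ δ) :
    r ∈ relaxedRegion δ Q := by
  classical
  have hzero : ∀ w, m w = 0 → jointFun (m w) = 0 ∧ sndFun (m w) = 0 ∧ -condFun (m w) = 0 := by
    intro w hw
    have : m w = fun a => 0 * m w a := by funext a; simp [hw]
    rw [this, jointFun_mul, sndFun_mul, condFun_mul]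
    simp
  -- The functional allowed to change is -H(Y|X,W): lowering it only lowers I(W ∧ Y | X).
  obtain ⟨l, hl, hcard, hlm, hl1, hl2, hl3⟩ := exists_sparse_weight m hm
    (fun w => jointFun (m w)) (fun w => sndFun (m w)) (fun w => -condFun (m w)) hzero
  set S := Finset.univ.filter fun w => l w ≠ 0 with hS
  let e := S.equivFin.symm
  have hsum : ∀ u : ι → ℝ, (∀ w, l w = 0 → u w = 0) → ∑ j, u (e j) = ∑ w, u w := fun u hu => by
    rw [Equiv.sum_comp e fun w : S => u w, Finset.sum_coe_sort S u]
    exact Finset.sum_subset (Finset.subset_univ _) fun w _ hw => hu w (by simpa [hS] using hw)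
  have hlmQ : ∀ a, ∑ j, l (e j) * m (e j) a = Q a := fun a => by
    rw [hsum (fun w => l w * m w a) (fun w hw => by simp [hw]), hlm, hmQ]
  have hlm0 : ∀ j a, 0 ≤ l (e j) * m (e j) a := fun j a => mul_nonneg (hl _) (hm _ _)
  have hQ : ∀ a, 0 ≤ Q a := fun a => by
    rw [← hmQ]
    exact Finset.sum_nonneg fun w _ => hm w a
  have j₀ : Fin S.card := by
    refine ⟨0, Nat.pos_of_ne_zero fun h => ?_⟩
    have h0 : ∀ a, Q a = 0 := fun a => by
      rw [← hlmQ]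
      exact Finset.sum_eq_zero fun j _ => absurd j.pos (by omega)
    simp [h0] at hQ1
  -- Bayes' rule; off the support of `Q` any distribution serves, here a point mass.
  let V : X × Y → Fin S.card → ℝ := fun a j =>
    if Q a = 0 then (if j = j₀ then 1 else 0) else l (e j) * m (e j) a / Q a
  have hV : ∀ a, V a ∈ stdSimplex ℝ (Fin S.card) := fun a => by
    by_cases h : Q a = 0
    · refine ⟨fun j => ?_, by simp [V, h]⟩
      simp only [V, h, if_true]
      split_ifs <;> simp
    · simp only [V, h, if_false]
      exact ⟨fun j => div_nonneg (hlm0 j a) (hQ a), by rw [← Finset.sum_div, hlmQ, div_self h]⟩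
  have hQV : ∀ j, (fun a => Q a * V a j) = fun a => l (e j) * m (e j) a := fun j => by
    funext a
    by_cases h : Q a = 0
    · have h2 := (Finset.sum_eq_zero_iff_of_nonneg fun j _ => hlm0 j a).mp ((hlmQ a).trans h) j
        (Finset.mem_univ j)
      rw [h, h2, zero_mul]
    · simp only [V, h, if_false]
      field_simp
  rw [Fintype.card_prod] at hcard
  refine mem_relaxedRegion_of_channel hcard hQ hV (le_trans (le_of_eq ?_) h1)
    (le_trans (le_of_eq ?_) h2) (le_trans ?_ h3)
  · simp_rw [hQV, jointFun_mul]
    rw [hsum (fun w => l w * jointFun (m w)) (fun w hw => by simp [hw]), hl1]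
  · simp_rw [hQV, sndFun_mul]
    rw [hsum (fun w => l w * sndFun (m w)) (fun w hw => by simp [hw]), hl2]
  · simp_rw [hQV, condFun_mul]
    rw [hsum (fun w => l w * condFun (m w)) (fun w hw => by simp [hw])]
    simp only [mul_neg, Finset.sum_neg_distrib] at hl3
    linarith

end

/-! ### Single-letterization -/

/-- The first `k` letters of a sequence. -/
def past {β : Type*} {n : ℕ} (k : ℕ) (s : Fin n → β) : Fin n → Option β :=
  fun j => if j.val < k then some (s j) else none

lemma past_eq_iff {β : Type*} {n : ℕ} (k : ℕ) (s t : Fin n → β) :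
    past k s = past k t ↔ ∀ j : Fin n, j.val < k → s j = t j := by
  rw [funext_iff]
  refine forall_congr' fun j => ?_
  by_cases h : j.val < k <;> simp [past, h]

section

variable {Ω β μ : Type*} [Fintype Ω] [Fintype β] [Fintype μ] {n : ℕ}

/-- The chain rule for entropy. -/
lemma sum_ent_past (p : Ω → ℝ) (z : Ω → Fin n → β) (u : Ω → μ) :
    ∑ i : Fin n, (ent p (fun ω => (z ω i, u ω, past i (z ω))) - ent p fun ω => (u ω, past i (z ω)))
      = ent p (fun ω => (z ω, u ω)) - ent p u := by
  let a : ℕ → ℝ := fun k => ent p fun ω => (u ω, past k (z ω))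
  -- Adjoining the i-th letter to the past of i yields the past of i + 1, so the sum telescopes.
  have hstep : ∀ i : Fin n, ent p (fun ω => (z ω i, u ω, past i (z ω))) = a (i + 1) := fun i => by
    refine ent_congr p fun ω ω' => ?_
    simp only [Prod.mk.injEq, past_eq_iff]
    constructor
    · rintro ⟨h1, h2, h3⟩
      refine ⟨h2, fun j hj => ?_⟩
      rcases (Nat.lt_succ_iff.mp hj).lt_or_eq with h | h
      · exact h3 j h
      · rwa [Fin.ext h]
    · rintro ⟨h1, h2⟩
      exact ⟨h2 i (Nat.lt_succ_self _), h1, fun j hj => h2 j (Nat.lt_succ_of_lt hj)⟩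
  simp_rw [hstep]
  rw [Fin.sum_univ_eq_sum_range (fun i => a (i + 1) - a i) n, Finset.sum_range_sub]
  congr 1
  · refine ent_congr p fun ω ω' => ?_
    simp only [Prod.mk.injEq, past_eq_iff]
    exact ⟨fun h => ⟨funext fun j => h.2 j j.isLt, h.1⟩, fun h => ⟨h.2, fun j _ => congrFun h.1 j⟩⟩
  · refine ent_congr p fun ω ω' => ?_
    simp [past_eq_iff]

end

lemma law_type {X Y : Type*} [Fintype X] [Fintype Y] {n : ℕ} (s : Fin n → X × Y) :
    law (type s) Prod.fst = type fun i => (s i).1 := by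
  classical
  funext x
  -- A type is the law of the letter at a uniformly random index.
  have h : ∀ (α : Type _) (t : Fin n → α), type t = law (fun _ => 1 / (n : ℝ)) t := fun α t => by
    funext a
    rw [type_eq_count, law_apply, count]
    simp [div_eq_mul_inv]
  rw [h _ s, law_law, type_eq_count, law_apply, count]
  simp [div_eq_mul_inv]

/-- The pair of sequences as a sequence of pairs. -/
def zip {X Y : Type*} {n : ℕ} (s : (Fin n → X) × (Fin n → Y)) : Fin n → X × Y :=
  fun i => (s.1 i, s.2 i)

lemma zip_injective {X Y : Type*} {n : ℕ} : (zip : (Fin n → X) × (Fin n → Y) → _).Injective := by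
  intro s t h
  simp only [zip, funext_iff, Prod.mk.injEq] at h
  exact Prod.ext (funext fun i => (h i).1) (funext fun i => (h i).2)

section

variable {X Y M₀ M₂ : Type*} [Fintype X] [Fintype Y] [Fintype M₀] [Fintype M₂] {n : ℕ}

/-- Correctly decoded pairs of sequences of a common type force rates in the relaxed region. -/
lemma mem_relaxedRegion_of_correct (hn : 1 ≤ n) (Φ : Code X Y n M₀ M₂)
    {s₀ : (Fin n → X) × (Fin n → Y)} (A : Finset ((Fin n → X) × (Fin n → Y))) (hne : A.Nonempty)
    (hA : ∀ s ∈ A, type (zip s) = type (zip s₀))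
    (hcorr : ∀ s ∈ A, Φ.dec (Φ.enc0 s.1, Φ.enc2 s.2) = s.2) {r : ℝ × ℝ} {δ : ℝ}
    (h1 : entropy (type (zip s₀)) -
      (Real.logb 2 A.card - Real.logb 2 (Fintype.card M₀)) / n ≤ r.1)
    (h2 : Real.logb 2 (Fintype.card M₂) / n ≤ r.2)
    (h3 : entropy (type (zip s₀)) - entropy (type s₀.1) -
      (Real.logb 2 A.card - n * entropy (type s₀.1)) / n ≤ δ) :
    r ∈ relaxedRegion δ (type (zip s₀)) := by
  classical
  have hn0 : (0 : ℝ) < n := by exact_mod_cast hn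
  have hc : (0 : ℝ) < A.card := by exact_mod_cast hne.card_pos
  let p : A → ℝ := fun _ => 1 / (A.card : ℝ)
  have hp : ∀ ω, 0 ≤ p ω := fun _ => by positivity
  have hs : ∑ ω, p ω = 1 := by simp [p, hc.ne']
  let z : A → Fin n → X × Y := fun ω => zip ω.1
  let x : A → Fin n → X := fun ω => ω.1.1
  let y : A → Fin n → Y := fun ω => ω.1.2
  let u : A → M₀ := fun ω => Φ.enc0 ω.1.1
  let W : Fin n → A → M₀ × (Fin n → Option (X × Y)) := fun i ω => (u ω, past i (z ω))
  have hzinj : z.Injective := fun a b h => Subtype.ext (zip_injective h)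
  have hjoint : Real.logb 2 A.card - Real.logb 2 (Fintype.card M₀) ≤
      ∑ i, (ent p (fun ω => (z ω i, W i ω)) - ent p (W i)) := by
    rw [sum_ent_past p z u, ent_const_of_injective (fun _ => rfl) (by simp) hc.ne'
      fun a b h => hzinj (Prod.mk.inj h).1]
    have := ent_le_logb_fintype_card hp hs u
    linarith
  -- The past of the pairs determines the past of y, so dropping the x-past can only raise the
  -- conditional entropies; the chain rule then leaves H(Y^n | U).
  have hsnd : ∑ i, (ent p (fun ω => ((z ω i).2, W i ω)) - ent p (W i)) ≤
      Real.logb 2 (Fintype.card M₂) := by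
    calc _ ≤ ∑ i : Fin n, (ent p (fun ω => (y ω i, u ω, past i (y ω))) -
          ent p fun ω => (u ω, past i (y ω))) := by
          refine Finset.sum_le_sum fun i _ => ent_sub_ent_le hp (fun ω => y ω i) (W i)
            (fun t => (t.1, fun j => (t.2 j).map Prod.snd)) fun ω => ?_
          refine Prod.ext rfl (funext fun j => ?_)
          by_cases h : j < i <;> simp [W, past, h, z, y, zip]
      _ = ent p (fun ω => (y ω, u ω)) - ent p u := sum_ent_past p y u
      _ ≤ _ := by
          let v : A → M₂ := fun ω => Φ.enc2 ω.1.2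
          have hyu : ent p (fun ω => (y ω, u ω)) ≤ ent p fun ω => (v ω, u ω) := by
            -- On A the decoder recovers y from both messages.
            have := ent_comp_le hp (fun ω => (v ω, u ω)) fun t => (Φ.dec (t.2, t.1), t.2)
            rwa [show (fun ω => (Φ.dec (u ω, v ω), u ω)) = fun ω => (y ω, u ω) from
              funext fun ω => by rw [hcorr ω.1 ω.2]] at this
          have := ent_prod_le hp hs v u
          have := ent_le_logb_fintype_card hp hs v
          linarith
  have hcond : Real.logb 2 A.card - n * entropy (type s₀.1) ≤
      ∑ i, (ent p (fun ω => (z ω i, W i ω)) - ent p fun ω => ((z ω i).1, W i ω)) := by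
    calc _ ≤ ent p (fun ω => (y ω, x ω)) - ent p x := by
          rw [ent_const_of_injective (f := fun ω => (y ω, x ω)) (fun _ => rfl) (by simp) hc.ne'
            fun a b h => Subtype.ext (Prod.ext (Prod.mk.inj h).2 (Prod.mk.inj h).1)]
          -- A common joint type forces a common type of x, so x ranges over a single type class.
          have h4 := ent_le_logb_card hp hs x (typeClass s₀.1) fun ω => by
            rw [mem_typeClass, ← type_eq_type_iff hn]
            have := congrArg (fun q => law q Prod.fst) (hA ω.1 ω.2)
            simp only [law_type] at this
            exact this
          have := logb_card_typeClass_le hn s₀.1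
          linarith
      _ = ∑ i : Fin n, (ent p (fun ω => (y ω i, x ω, past i (y ω))) -
          ent p fun ω => (x ω, past i (y ω))) := (sum_ent_past p y x).symm
      _ ≤ _ := by
          refine Finset.sum_le_sum fun i _ => ?_
          rw [ent_congr p (f := fun ω => (z ω i, W i ω))
            (g := fun ω => (y ω i, (z ω i).1, W i ω)) (by
              intro ω ω'
              simp only [z, y, zip, Prod.mk.injEq]
              tauto)]
          -- The whole of x with the past of y determines x_i, the helper's message and the past
          -- pairs.
          refine ent_sub_ent_le hp (fun ω => y ω i) (fun ω => (x ω, past i (y ω)))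
            (fun t => (t.1 i, Φ.enc0 t.1, fun j => (t.2 j).map fun b => (t.1 j, b))) fun ω => ?_
          refine Prod.ext rfl (Prod.ext rfl (funext fun j => ?_))
          by_cases h : j < i <;> simp [W, past, h, z, y, x, zip]
  -- Time sharing: the auxiliary variable is a uniform index i together with the value of W_i.
  let m : Fin n × (M₀ × (Fin n → Option (X × Y))) → X × Y → ℝ :=
    fun iw a => 1 / (n : ℝ) * slice p (fun ω => z ω iw.1) (W iw.1) iw.2 a
  -- Exact equality holds because each sequence in A has this type; averaging over indices first
  -- gives the type for every ω.
  have hmean : ∀ a, ∑ iw, m iw a = type (zip s₀) a := fun a => by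
    simp only [m, Fintype.sum_prod_type (α₁ := Fin n), slice, ← Finset.mul_sum]
    simp_rw [← law_fst, law_apply, Finset.sum_filter]
    rw [Finset.sum_comm]
    have : ∀ ω : A, (∑ i, if z ω i = a then p ω else 0) =
        1 / (A.card : ℝ) * (n * type (zip s₀) a) := fun ω => by
      rw [← hA ω.1 ω.2, ← count_eq_mul_type hn, ← Finset.sum_filter, Finset.sum_const, count,
        nsmul_eq_mul, mul_comm]
      congr!
    trans 1 / (n : ℝ) * ∑ _ω : A, 1 / (A.card : ℝ) * (n * type (zip s₀) a)
    · congr 1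
      exact Finset.sum_congr rfl fun ω _ => by convert this ω
    · simp only [Finset.sum_const, Finset.card_univ, Fintype.card_coe, nsmul_eq_mul]
      field_simp
  refine mem_relaxedRegion_of_decomposition (sum_type hn _) m (fun iw a => ?_) hmean
    (le_trans ?_ h1) (le_trans ?_ h2) (le_trans ?_ h3)
  · exact mul_nonneg (by positivity) (law_nonneg hp _ _)
  · simp only [m, Fintype.sum_prod_type (α₁ := Fin n), jointFun_mul, ← Finset.mul_sum,
      sum_jointFun_slice]
    rw [one_div_mul_eq_div]
    gcongr
  · simp only [m, Fintype.sum_prod_type (α₁ := Fin n), sndFun_mul, ← Finset.mul_sum,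
      sum_sndFun_slice]
    rw [one_div_mul_eq_div]
    gcongr
  · simp only [m, Fintype.sum_prod_type (α₁ := Fin n), condFun_mul, ← Finset.mul_sum,
      sum_condFun_slice]
    rw [one_div_mul_eq_div, law_type]
    change _ - entropy (type s₀.1) - _ ≤ _
    gcongr

/-! ### The converse bound -/

open Classical in
/-- The pairs of sequences with the same joint type as `s`. -/
def jointClass (s : (Fin n → X) × (Fin n → Y)) : Finset ((Fin n → X) × (Fin n → Y)) :=
  Finset.univ.filter fun t => type (zip t) = type (zip s)

lemma card_jointClass (hn : 1 ≤ n) (s : (Fin n → X) × (Fin n → Y)) :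
    (jointClass s).card = (typeClass (zip s)).card := by
  classical
  refine Finset.card_bij (fun t _ => zip t) (fun t ht => ?_) (fun _ _ _ _ h => zip_injective h)
    fun t ht => ⟨(fun i => (t i).1, fun i => (t i).2), ?_, rfl⟩
  · rw [mem_typeClass, ← type_eq_type_iff hn]
    simpa [jointClass] using ht
  · rw [mem_typeClass, ← type_eq_type_iff hn] at ht
    exact Finset.mem_filter.mpr ⟨Finset.mem_univ _, ht⟩

lemma logb_card_nonneg (α : Type*) [Fintype α] [Nonempty α] :
    0 ≤ Real.logb 2 (Fintype.card α) :=
  Real.logb_nonneg one_lt_two (by exact_mod_cast Fintype.card_pos)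

lemma logb_logb_card_nonneg (α : Type*) [Fintype α] :
    0 ≤ Real.logb 2 (Real.logb 2 (Fintype.card α)) := by
  rcases Nat.lt_or_ge (Fintype.card α) 2 with h | h
  -- For cardinality 0 or 1 the convention log 0 = 0 gives the value 0.
  · interval_cases Fintype.card α <;> simp
  · refine Real.logb_nonneg one_lt_two ?_
    rw [Real.le_logb_iff_rpow_le one_lt_two (by positivity), Real.rpow_one]
    exact_mod_cast h

open Classical in
/-- In a joint type class outside the relaxed region at most a fraction `1 / n` is decoded
correctly. -/
lemma mul_card_correct_le (hn : 1 ≤ n) (Φ : Code X Y n M₀ M₂) (s : (Fin n → X) × (Fin n → Y))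
    (hbad : (rate0 X Y M₀ n, rate2 Y M₂ n) ∉ relaxedRegion (delta X Y n) (type (zip s))) :
    n * ((jointClass s).filter fun t => Φ.dec (Φ.enc0 t.1, Φ.enc2 t.2) = t.2).card ≤
      (jointClass s).card := by
  by_contra! hlt
  refine hbad ?_
  set A := (jointClass s).filter fun t => Φ.dec (Φ.enc0 t.1, Φ.enc2 t.2) = t.2 with hA
  have hn0 : (0 : ℝ) < n := by exact_mod_cast hn
  have hne : A.Nonempty := by
    rw [Finset.nonempty_iff_ne_empty]
    intro h
    simp [h] at hlt
  have hc : (0 : ℝ) < A.card := by exact_mod_cast hne.card_pos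
  have hX : Nonempty X := ⟨s.1 ⟨0, hn⟩⟩
  have hY : Nonempty Y := ⟨s.2 ⟨0, hn⟩⟩
  have hlogn : Real.logb 2 n ≤ Real.logb 2 ((n : ℝ) + 1) :=
    Real.logb_le_logb_of_le one_lt_two hn0 (by linarith)
  have hlogn0 : 0 ≤ Real.logb 2 ((n : ℝ) + 1) :=
    Real.logb_nonneg one_lt_two (by linarith)
  -- The term |X||Y| is the loss in the size of the type class; the additional 1 absorbs log n from
  -- the fraction 1/n.
  have hcard : n * entropy (type (zip s)) -
      (Fintype.card X * Fintype.card Y + 1) * Real.logb 2 ((n : ℝ) + 1) ≤ Real.logb 2 A.card := by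
    have h1 := le_logb_card_typeClass hn (zip s)
    rw [← card_jointClass hn, Fintype.card_prod, Nat.cast_mul] at h1
    have h2 : (0 : ℝ) < (jointClass s).card := by
      exact_mod_cast Finset.card_pos.mpr ⟨s, by simp [jointClass]⟩
    have h3 : Real.logb 2 (jointClass s).card ≤ Real.logb 2 (n * A.card) :=
      Real.logb_le_logb_of_le one_lt_two h2 (by exact_mod_cast hlt.le)
    rw [Real.logb_mul hn0.ne' hc.ne'] at h3
    linarith
  have hslack : (Fintype.card X * Fintype.card Y + 1) * Real.logb 2 ((n : ℝ) + 1) / n ≤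
      Delta X Y n := by
    rw [Delta]
    gcongr ?_ * _ / _
    have : (0 : ℝ) ≤ Fintype.card X := by positivity
    linarith
  -- This one estimate yields both the bound on r₀ and, after H(Q_X) cancels, the bound on δ; the
  -- other penalty terms are nonnegative slack.
  have hgap : entropy (type (zip s)) - Real.logb 2 A.card / n ≤ Delta X Y n := by
    refine le_trans ?_ hslack
    rw [le_div_iff₀ hn0, sub_mul, div_mul_cancel₀ _ hn0.ne']
    linarith
  refine mem_relaxedRegion_of_correct hn Φ (s₀ := s) A hne (fun t ht => ?_) (fun t ht => ?_)
    ?_ ?_ ?_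
  · simpa [jointClass] using (Finset.mem_filter.mp ht).1
  · exact (Finset.mem_filter.mp ht).2
  · have h4 : 0 ≤ (Real.logb 2 (Real.logb 2 (Fintype.card X)) + 2) / (n : ℝ) :=
      div_nonneg (by linarith [logb_logb_card_nonneg X]) hn0.le
    rw [rate0, sub_div, one_div_mul_eq_div]
    linarith
  · have h4 : 0 ≤ (1 + Real.logb 2 (Fintype.card Y)) / (n : ℝ) :=
      div_nonneg (by linarith [logb_card_nonneg Y]) hn0.le
    rw [rate2, one_div_mul_eq_div]
    linarith
  · have h4 : 0 ≤ (Real.logb 2 (Real.logb 2 (Fintype.card X)) + 3 + Real.logb 2 (Fintype.card X)) /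
        (n : ℝ) := div_nonneg (by linarith [logb_logb_card_nonneg X, logb_card_nonneg X]) hn0.le
    rw [delta, sub_div, mul_div_cancel_left₀ _ hn0.ne']
    linarith

lemma iidLaw_eq_of_type_eq (hn : 1 ≤ n) (P : X × Y → ℝ) {s t : (Fin n → X) × (Fin n → Y)}
    (h : type (zip s) = type (zip t)) : iidLaw P n s = iidLaw P n t := by
  change ∏ i, P (zip s i) = ∏ i, P (zip t i)
  rw [prod_comp_eq_prod_pow_count, prod_comp_eq_prod_pow_count, (type_eq_type_iff hn _ _).mp h]

end

end WAK

end

/-! ### Summation over joint types -/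

theorem corollary1 {X Y M₀ M₂ : Type*} [Fintype X] [Fintype Y] [Fintype M₀] [Fintype M₂]
    (P : X × Y → ℝ) (hP : P ∈ stdSimplex ℝ (X × Y)) (n : ℕ) (hn : 1 ≤ n)
    (Φ : WAK.Code X Y n M₀ M₂) :
    WAK.prob (WAK.iidLaw P n)
        {s | (WAK.rate0 X Y M₀ n, WAK.rate2 Y M₂ n) ∉
              WAK.relaxedRegion (WAK.delta X Y n) (WAK.type fun i => (s.1 i, s.2 i)) ∧
            WAK.type s.1 ∈ WAK.typeSet X M₀ n} *
        (1 - 1 / (n : ℝ)) ≤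
      WAK.errorProb Φ (WAK.iidLaw P n) := by
  classical
  have hn1 : (1 : ℝ) ≤ n := by exact_mod_cast hn
  have hn0 : (0 : ℝ) < n := by linarith
  have hp : ∀ s, 0 ≤ WAK.iidLaw P n s := fun s => Finset.prod_nonneg fun i _ => hP.1 _
  have hfrac : (0 : ℝ) ≤ 1 - 1 / n := sub_nonneg.mpr ((div_le_one hn0).mpr hn1)
  let τ : (Fin n → X) × (Fin n → Y) → (X × Y → ℝ) := fun s => WAK.type (WAK.zip s)
  let bad : (X × Y → ℝ) → Prop := fun Q =>
    (WAK.rate0 X Y M₀ n, WAK.rate2 Y M₂ n) ∉ WAK.relaxedRegion (WAK.delta X Y n) Q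
  let err : (Fin n → X) × (Fin n → Y) → Prop := fun s => Φ.dec (Φ.enc0 s.1, Φ.enc2 s.2) ≠ s.2
  -- Within one class the law is constant and badness is all or nothing, so the claim reduces to
  -- counting correctly decoded pairs.
  have hclass : ∀ Q ∈ Finset.univ.image τ,
      (∑ s with τ s = Q, if bad (τ s) then WAK.iidLaw P n s else 0) * (1 - 1 / (n : ℝ)) ≤
        ∑ s with τ s = Q, if err s then WAK.iidLaw P n s else 0 := by
    intro Q hQ
    obtain ⟨s, -, rfl⟩ := Finset.mem_image.mp hQ
    have hJ : (Finset.univ.filter fun t => τ t = τ s) = WAK.jointClass s := by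
      ext t; simp [WAK.jointClass, τ]
    rw [hJ]
    have hmem : ∀ t ∈ WAK.jointClass s, τ t = τ s := fun t ht => by
      simpa [WAK.jointClass] using ht
    by_cases hb : bad (τ s)
    · have hcorrect := WAK.mul_card_correct_le hn Φ s hb
      have hsplit := Finset.card_filter_add_card_filter_not (s := WAK.jointClass s) err
      have hL : (∑ t ∈ WAK.jointClass s, if bad (τ t) then WAK.iidLaw P n t else 0) =
          (WAK.jointClass s).card * WAK.iidLaw P n s := by
        rw [← nsmul_eq_mul, ← Finset.sum_const]
        refine Finset.sum_congr rfl fun t ht => ?_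
        rw [hmem t ht, if_pos hb, WAK.iidLaw_eq_of_type_eq hn P (hmem t ht)]
      have hR : (∑ t ∈ WAK.jointClass s, if err t then WAK.iidLaw P n t else 0) =
          ((WAK.jointClass s).filter err).card * WAK.iidLaw P n s := by
        rw [← Finset.sum_filter, ← nsmul_eq_mul, ← Finset.sum_const]
        refine Finset.sum_congr rfl fun t ht => ?_
        rw [WAK.iidLaw_eq_of_type_eq hn P (hmem t (Finset.mem_filter.mp ht).1)]
      rw [hL, hR, mul_right_comm]
      refine mul_le_mul_of_nonneg_right ?_ (hp s)
      have hnot : ((WAK.jointClass s).filter fun t => ¬ err t).card =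
          ((WAK.jointClass s).filter fun t => Φ.dec (Φ.enc0 t.1, Φ.enc2 t.2) = t.2).card := by
        simp [err]
      rw [hnot] at hsplit
      have h1 : ((WAK.jointClass s).filter fun t =>
          Φ.dec (Φ.enc0 t.1, Φ.enc2 t.2) = t.2).card ≤ ((WAK.jointClass s).card : ℝ) / n := by
        rw [le_div_iff₀ hn0, mul_comm]
        exact_mod_cast hcorrect
      have h2 : (((WAK.jointClass s).filter err).card : ℝ) + ((WAK.jointClass s).filter fun t =>
          Φ.dec (Φ.enc0 t.1, Φ.enc2 t.2) = t.2).card = (WAK.jointClass s).card := by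
        exact_mod_cast hsplit
      rw [mul_sub, mul_one, mul_one_div]
      linarith
    · rw [Finset.sum_eq_zero fun t ht => by rw [hmem t ht, if_neg hb], zero_mul]
      exact Finset.sum_nonneg fun t _ => by split_ifs <;> simp [hp t]
  calc _ ≤ (∑ s, if bad (τ s) then WAK.iidLaw P n s else 0) * (1 - 1 / (n : ℝ)) := by
        refine mul_le_mul_of_nonneg_right ?_ hfrac
        -- Dropping the condition on the type of X^n only enlarges the event.
        rw [WAK.prob_eq_sum, ← Finset.sum_filter]
        refine Finset.sum_le_sum_of_subset_of_nonneg (fun s hs => ?_) fun _ _ _ => hp _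
        simp only [Finset.mem_filter, Finset.mem_univ, true_and, Set.mem_ofPred_eq] at hs ⊢
        exact hs.1
    _ = ∑ Q ∈ Finset.univ.image τ, (∑ s with τ s = Q,
          if bad (τ s) then WAK.iidLaw P n s else 0) * (1 - 1 / (n : ℝ)) := by
        rw [← Finset.sum_mul, Finset.sum_fiberwise_of_maps_to fun s _ =>
          Finset.mem_image_of_mem τ (Finset.mem_univ s)]
    _ ≤ ∑ Q ∈ Finset.univ.image τ, ∑ s with τ s = Q, if err s then WAK.iidLaw P n s else 0 :=
        Finset.sum_le_sum hclass
    _ = WAK.errorProb Φ (WAK.iidLaw P n) := by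
        rw [Finset.sum_fiberwise_of_maps_to fun s _ =>
          Finset.mem_image_of_mem τ (Finset.mem_univ s), WAK.errorProb, WAK.prob_eq_sum,
          ← Finset.sum_filter]
        refine Finset.sum_congr ?_ fun _ _ => rfl
        ext
        simp [err]
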